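/- For $a,b>0$ and $0\le x\le 1$ let $$I_x(a,b)=\frac{1}{B(a,b)}\int_0^x t^{a-1}(1-t)^{b-1}\,dt$$ be the regularized incomplete Beta function, where $B(a,b)=\Gamma(a)\Gamma(b)/\Gamma(a+b)$, and let $\|\cdot\|$ be the Euclidean norm on $\mathbb{R}^d$. 1. (Gaussian and uniform on the sphere.) Let $d\ge 2$ and let $\mathcal{D}$ be either the standard Gaussian distribution $\mathcal{N}(0,I_d)$ or the uniform distribution on the unit sphere $\mathbb{S}^{d-1}\subset\mathbb{R}^d$. Then for every $g\in\mathbb{R}^d\setminus\{0\}$ and every $\gamma\in(0,1]$, $$\mathbb{P}_{u\sim\mathcal{D}}\left[|u^\top g|\ge\gamma\|u\|\|g\|\right]=I_{1-\gamma^2}\left(\frac{d-1}{2},\frac12\right).$$ Moreover, for every $g\in\mathbb{R}^d$, $$\mathbb{P}_{u\sim\mathcal{D}}\left[|u^\top g|\ge\frac{\|u\|\|g\|}{\sqrt d}\right]\ge 0.315603.$$ 2. (Random coordinate direction.) Let $d\ge 1$ and let $\mathcal{D}$ be the uniform distribution on the set $\{e_1,\dots,e_d\}$ of standard basis vectors of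 $\mathbb{R}^d$. Then for every $g\in\mathbb{R}^d$, $$\mathbb{P}_{u\sim\mathcal{D}}\left[|u^\top g|\ge\frac{\|u\|\|g\|}{\sqrt d}\right]\ge\frac1d.$$ -/

import Mathlib

open MeasureTheory

/-- The regularized incomplete Beta function
`I_x(a, b) = (1 / B(a, b)) * ∫_0^x t^(a-1) (1-t)^(b-1) dt`, for `a, b > 0` and `0 ≤ x ≤ 1`. -/
noncomputable def regIncBeta (x a b : ℝ) : ℝ :=
  (∫ t in (0 : ℝ)..x, t ^ (a - 1) * (1 - t) ^ (b - 1)) / ProbabilityTheory.beta a b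

/-- The standard normal distribution `N(0, I_d)` on `ℝ^d`. -/
noncomputable def gaussianDir (d : ℕ) : Measure (EuclideanSpace ℝ (Fin d)) :=
  ProbabilityTheory.multivariateGaussian 0 1

/-- The uniform distribution on the Euclidean unit sphere of `ℝ^d`, as a measure on `ℝ^d`:
the surface measure, normalized to total mass one. -/
noncomputable def sphereDir (d : ℕ) : Measure (EuclideanSpace ℝ (Fin d)) :=
  (((volume : Measure (EuclideanSpace ℝ (Fin d))).toSphere Set.univ)⁻¹ •
    (volume : Measure (EuclideanSpace ℝ (Fin d))).toSphere).map Subtype.val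

/-- The uniform distribution on the set `{e_1, …, e_d}` of standard basis vectors of `ℝ^d`. -/
noncomputable def coordDir (d : ℕ) : Measure (EuclideanSpace ℝ (Fin d)) :=
  ProbabilityTheory.uniformOn (Set.range fun i : Fin d => EuclideanSpace.single i (1 : ℝ))

instance isProbabilityMeasure_gaussianDir (d : ℕ) : IsProbabilityMeasure (gaussianDir d) := by
  unfold gaussianDir; infer_instance

instance isProbabilityMeasure_sphereDir (d : ℕ) [NeZero d] :
    IsProbabilityMeasure (sphereDir d) := by
  have h : (volume : Measure (EuclideanSpace ℝ (Fin d))).toSphere ≠ 0 := by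
    rw [Ne, Measure.toSphere_eq_zero_iff_finrank]
    simpa using NeZero.ne d
  have : NeZero (volume : Measure (EuclideanSpace ℝ (Fin d))).toSphere := ⟨h⟩
  exact Measure.isProbabilityMeasure_map measurable_subtype_coe.aemeasurable

instance isProbabilityMeasure_coordDir (d : ℕ) [NeZero d] :
    IsProbabilityMeasure (coordDir d) :=
  ProbabilityTheory.isProbabilityMeasure_uniformOn (Set.finite_range _) (Set.range_nonempty _)

/-! The event is a cone in `u`, and integrating the Gaussian in polar form shows that it gives every
measurable cone the normalized surface measure of its trace on the sphere, so both laws reduce to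
the Gaussian. A reflection carries the first axis to the direction of `g`, so `u` becomes a pair
`(z, y)` of a real Gaussian and an independent Gaussian vector in dimension `d - 1`, and the event
becomes `γ √(z² + ‖y‖²) ≤ |z|`. In polar coordinates of the half-plane `(‖y‖, z)` the radius factors
out and the angle has density proportional to `cos^(d-2)`; substituting `t = cos² θ` turns this into
the Beta law of `1 - γ²`.

For the numerical bound, `γ = 1/√d` makes the event `|z| ≥ ‖y‖/√(d-1)`. Put `s = ‖y‖²/(d-1)`, which
has mean 1. The tail `P(|z| ≥ √s)` lies above its tangent line at `s = 1`, so averaging over `y`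
gives at least `P(|z| ≥ 1)`, for every `d`. For coordinate directions, a largest coordinate of `g`
already suffices. -/

/-! ### Gaussian density and polar integration over cones -/

-- Both sides are finite measures with the same characteristic function, by the Fourier transform of
-- `exp (-‖x‖²/2)`.
open ProbabilityTheory Module in
theorem stdGaussian_eq_withDensity (E : Type*) [NormedAddCommGroup E] [InnerProductSpace ℝ E]
    [FiniteDimensional ℝ E] [MeasurableSpace E] [BorelSpace E] :
    stdGaussian E = (volume : Measure E).withDensity fun x ↦
      ENNReal.ofReal ((2 * Real.pi) ^ (-(finrank ℝ E / 2 : ℝ)) * Real.exp (-‖x‖ ^ 2 / 2)) := by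
  have hpos : (0 : ℝ) < 2 * Real.pi := by positivity
  have hInt : Integrable (fun x : E ↦
      (2 * Real.pi) ^ (-(finrank ℝ E / 2 : ℝ)) * Real.exp (-‖x‖ ^ 2 / 2)) := by
    refine Integrable.const_mul ?_ _
    have h := GaussianFourier.integrable_cexp_neg_mul_sq_norm_add (V := E) (b := 1 / 2)
      (by norm_num) 0 0
    have := h.norm
    refine this.congr (ae_of_all _ fun x ↦ ?_)
    simp only [Complex.norm_exp]
    congr 1
    norm_num [← Complex.ofReal_pow]
    ring
  have : IsFiniteMeasure ((volume : Measure E).withDensity fun x ↦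
      ENNReal.ofReal ((2 * Real.pi) ^ (-(finrank ℝ E / 2 : ℝ)) * Real.exp (-‖x‖ ^ 2 / 2))) :=
    isFiniteMeasure_withDensity_ofReal hInt.2
  refine Measure.ext_of_charFun (funext fun t ↦ ?_)
  rw [charFun_stdGaussian, charFun_apply, integral_withDensity_eq_integral_toReal_smul
    (by fun_prop) (ae_of_all _ fun _ ↦ ENNReal.ofReal_lt_top)]
  have key := GaussianFourier.integral_cexp_neg_mul_sq_norm_add (V := E) (b := 1 / 2)
    (by norm_num) Complex.I t
  have h1 : ∀ x : E, (ENNReal.ofReal ((2 * Real.pi) ^ (-(finrank ℝ E / 2 : ℝ)) *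
      Real.exp (-‖x‖ ^ 2 / 2))).toReal • Complex.exp ((inner ℝ x t : ℝ) * Complex.I) =
      (((2 * Real.pi) ^ (-(finrank ℝ E / 2 : ℝ)) : ℝ) : ℂ) *
        Complex.exp (-(1 / 2) * (‖x‖ : ℂ) ^ 2 + Complex.I * (inner ℝ t x : ℝ)) := by
    intro x
    rw [ENNReal.toReal_ofReal (by positivity), Complex.real_smul, Complex.ofReal_mul, mul_assoc,
      Complex.ofReal_exp, ← Complex.exp_add, real_inner_comm]
    congr 2
    push_cast
    ring
  simp_rw [h1, integral_const_mul, key]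
  rw [← mul_assoc]
  have h2 : ((Real.pi : ℂ) / (1 / 2)) ^ ((finrank ℝ E : ℂ) / 2) =
      (((2 * Real.pi) ^ (finrank ℝ E / 2 : ℝ) : ℝ) : ℂ) := by
    rw [Complex.ofReal_cpow hpos.le]
    push_cast
    congr 1
    ring
  rw [h2, ← Complex.ofReal_mul, ← Real.rpow_add hpos]
  simp
  ring_nf

open Module in
theorem lintegral_eq_lintegral_toSphere_prod {E : Type*} [NormedAddCommGroup E] [NormedSpace ℝ E]
    [FiniteDimensional ℝ E] [Nontrivial E] [MeasurableSpace E] [BorelSpace E] (μ : Measure E)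
    [μ.IsAddHaarMeasure] (f : E → ENNReal) :
    ∫⁻ x, f x ∂μ = ∫⁻ p, f (p.2.1 • p.1.1)
      ∂(μ.toSphere.prod (Measure.volumeIoiPow (finrank ℝ E - 1))) := by
  have h := μ.measurePreserving_homeomorphUnitSphereProd.lintegral_comp_emb
    (Homeomorph.measurableEmbedding _)
    (fun p ↦ f (p.2.1 • p.1.1))
  rw [← h]
  have h2 : ∀ x : ({0}ᶜ : Set E), f ((homeomorphUnitSphereProd E x).2.1 •
      (homeomorphUnitSphereProd E x).1.1) = f x.1 := fun x ↦ by
    congr 1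
    exact congrArg Subtype.val ((homeomorphUnitSphereProd E).symm_apply_apply x)
  simp_rw [h2]
  rw [lintegral_subtype_comap (measurableSet_singleton _).compl, restrict_compl_singleton]

-- Membership in a cone depends only on the direction, so the integrand on sphere × ray is a
-- product.
open Module in
theorem setLIntegral_cone_fun_norm {E : Type*} [NormedAddCommGroup E] [NormedSpace ℝ E]
    [FiniteDimensional ℝ E] [Nontrivial E] [MeasurableSpace E] [BorelSpace E] (μ : Measure E)
    [μ.IsAddHaarMeasure] {A : Set E} (hA : MeasurableSet A)
    (hcone : ∀ r : ℝ, 0 < r → ∀ x, r • x ∈ A ↔ x ∈ A) {h : ℝ → ENNReal} (hh : Measurable h) :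
    ∫⁻ x in A, h ‖x‖ ∂μ = μ.toSphere (Subtype.val ⁻¹' A) *
      ∫⁻ r in Set.Ioi (0 : ℝ), ENNReal.ofReal (r ^ (finrank ℝ E - 1)) * h r := by
  rw [← lintegral_indicator hA, lintegral_eq_lintegral_toSphere_prod]
  have h1 : ∀ p : Metric.sphere (0 : E) 1 × Set.Ioi (0 : ℝ),
      A.indicator (fun x ↦ h ‖x‖) (p.2.1 • p.1.1) =
        (Subtype.val ⁻¹' A).indicator 1 p.1 * h p.2.1 := by
    rintro ⟨x, r, hr⟩
    have hr' : (0 : ℝ) < r := hr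
    by_cases hx : x.1 ∈ A
    · rw [Set.indicator_of_mem ((hcone r hr' x).2 hx)]
      simp [norm_smul, abs_of_pos hr', hx]
    · rw [Set.indicator_of_notMem fun h ↦ hx ((hcone r hr' x).1 h)]
      simp [hx]
  simp_rw [h1]
  have hA' : MeasurableSet (Subtype.val ⁻¹' A : Set (Metric.sphere (0 : E) 1)) :=
    measurable_subtype_coe hA
  rw [lintegral_prod_mul (f := (Subtype.val ⁻¹' A).indicator 1) (g := fun r : Set.Ioi (0 : ℝ) ↦ h r)
    (measurable_one.indicator hA').aemeasurable (hh.comp measurable_subtype_coe).aemeasurable,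
    lintegral_indicator_one hA', Measure.volumeIoiPow,
    lintegral_withDensity_eq_lintegral_mul _ (by fun_prop) (by fun_prop)]
  congr 1
  exact lintegral_subtype_comap measurableSet_Ioi
    (fun r ↦ ENNReal.ofReal (r ^ (finrank ℝ E - 1)) * h r)

theorem gaussianDir_eq_stdGaussian (d : ℕ) :
    gaussianDir d = ProbabilityTheory.stdGaussian (EuclideanSpace ℝ (Fin d)) :=
  ProbabilityTheory.multivariateGaussian_zero_one

theorem sphereDir_cone_eq_gaussianDir {d : ℕ} (hd : d ≠ 0) {A : Set (EuclideanSpace ℝ (Fin d))}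
    (hA : MeasurableSet A) (hcone : ∀ r : ℝ, 0 < r → ∀ x, r • x ∈ A ↔ x ∈ A) :
    sphereDir d A = gaussianDir d A := by
  have : NeZero d := ⟨hd⟩
  set ψ : ℝ → ENNReal := fun r ↦ ENNReal.ofReal
    ((2 * Real.pi) ^ (-(Module.finrank ℝ (EuclideanSpace ℝ (Fin d)) / 2 : ℝ)) *
      Real.exp (-r ^ 2 / 2))
  have hψ : Measurable ψ := by fun_prop
  have hG : ∀ B : Set (EuclideanSpace ℝ (Fin d)), MeasurableSet B →
      (∀ r : ℝ, 0 < r → ∀ x, r • x ∈ B ↔ x ∈ B) → gaussianDir d B =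
        (volume : Measure (EuclideanSpace ℝ (Fin d))).toSphere (Subtype.val ⁻¹' B) *
        ∫⁻ r in Set.Ioi (0 : ℝ), ENNReal.ofReal
          (r ^ (Module.finrank ℝ (EuclideanSpace ℝ (Fin d)) - 1)) * ψ r := by
    intro B hB hBc
    rw [gaussianDir_eq_stdGaussian, stdGaussian_eq_withDensity, withDensity_apply _ hB,
      ← setLIntegral_cone_fun_norm _ hB hBc hψ]
  -- The whole space is a cone too: this identifies the radial integral as the inverse of the total
  -- surface mass, with no computation.
  have h1 := hG Set.univ .univ (by simp)
  rw [measure_univ, Set.preimage_univ] at h1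
  rw [hG A hA hcone, sphereDir, Measure.map_apply measurable_subtype_coe hA, Measure.smul_apply,
    smul_eq_mul, ENNReal.eq_inv_of_mul_eq_one_left ((mul_comm _ _).trans h1.symm), mul_comm]

/-! ### The Beta law in the angle variable -/

theorem image_cos_sq_Ioo :
    (fun θ ↦ Real.cos θ ^ 2) '' Set.Ioo 0 (Real.pi / 2) = Set.Ioo 0 1 := by
  ext t
  constructor
  · rintro ⟨θ, ⟨h0, h1⟩, rfl⟩
    have hc := Real.cos_pos_of_mem_Ioo ⟨by linarith, h1⟩
    have hs := Real.sin_pos_of_pos_of_lt_pi h0 (by linarith [Real.pi_pos])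
    exact ⟨by positivity, by nlinarith [Real.sin_sq_add_cos_sq θ]⟩
  · rintro ⟨h0, h1⟩
    have hs : √t < 1 := by rw [Real.sqrt_lt' one_pos]; simpa
    refine ⟨Real.arccos √t, ⟨Real.arccos_pos.2 hs, Real.arccos_lt_pi_div_two.2 (Real.sqrt_pos.2 h0)⟩,
      ?_⟩
    simp only
    rw [Real.cos_arccos (by linarith [Real.sqrt_nonneg t]) hs.le, Real.sq_sqrt h0.le]

/-- Substitute `t = cos² θ`: the density contributes `cos^(m-1) θ / sin θ`, the Jacobian `2 cos θ
sin θ`, and `t ≤ 1 - γ²` reads `γ ≤ sin θ`. -/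
theorem betaMeasure_Iic_eq_lintegral_cos (m : ℕ) {γ : ℝ} (hγ : 0 ≤ γ) :
    ProbabilityTheory.betaMeasure ((m + 1) / 2) (1 / 2) (Set.Iic (1 - γ ^ 2)) =
      ENNReal.ofReal (2 / ProbabilityTheory.beta ((m + 1) / 2) (1 / 2)) *
      ∫⁻ θ in Set.Ioo 0 (Real.pi / 2),
        if γ ≤ Real.sin θ then ENNReal.ofReal (Real.cos θ ^ m) else 0 := by
  have hB : 0 < ProbabilityTheory.beta (((m : ℝ) + 1) / 2) (1 / 2) :=
    ProbabilityTheory.beta_pos (by positivity) (by norm_num)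
  rw [ProbabilityTheory.betaMeasure, withDensity_apply _ measurableSet_Iic,
    ← lintegral_indicator measurableSet_Iic]
  have h1 : ∀ t, (Set.Iic (1 - γ ^ 2)).indicator
      (ProbabilityTheory.betaPDF ((m + 1) / 2) (1 / 2)) t = (Set.Ioo (0 : ℝ) 1).indicator
      ((Set.Iic (1 - γ ^ 2)).indicator (ProbabilityTheory.betaPDF ((m + 1) / 2) (1 / 2))) t := by
    intro t
    by_cases ht : t ∈ Set.Ioo (0 : ℝ) 1
    · rw [Set.indicator_of_mem ht]
    · rw [Set.indicator_of_notMem ht]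
      refine Set.indicator_apply_eq_zero.2 fun _ ↦ ?_
      rw [ProbabilityTheory.betaPDF_eq, if_neg (by exact ht), ENNReal.ofReal_zero]
  simp_rw [h1]
  rw [lintegral_indicator measurableSet_Ioo, ← image_cos_sq_Ioo,
    lintegral_image_eq_lintegral_abs_deriv_mul measurableSet_Ioo
      (f' := fun θ ↦ -(2 * Real.cos θ * Real.sin θ)), ← lintegral_const_mul']
  · refine setLIntegral_congr_fun measurableSet_Ioo fun θ ⟨h0, h2⟩ ↦ ?_
    have hc := Real.cos_pos_of_mem_Ioo ⟨by linarith, h2⟩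
    have hs := Real.sin_pos_of_pos_of_lt_pi h0 (by linarith [Real.pi_pos])
    have hsc := Real.sin_sq_add_cos_sq θ
    have hiff : Real.cos θ ^ 2 ∈ Set.Iic (1 - γ ^ 2) ↔ γ ≤ Real.sin θ := by
      rw [Set.mem_Iic, ← sq_le_sq₀ hγ hs.le]
      constructor <;> intro h <;> linarith
    split_ifs with h
    · rw [Set.indicator_of_mem (hiff.2 h), ProbabilityTheory.betaPDF_of_pos_lt_one (by positivity)
        (by nlinarith), ← ENNReal.ofReal_mul (by positivity), ← ENNReal.ofReal_mul (by positivity)]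
      congr 1
      have e1 : (1 : ℝ) - Real.cos θ ^ 2 = Real.sin θ ^ 2 := by linarith
      rw [e1, ← Real.rpow_natCast_mul hc.le, ← Real.rpow_natCast_mul hs.le, abs_neg,
        abs_of_pos (by positivity)]
      have e2 : ((2 : ℕ) : ℝ) * (((m : ℝ) + 1) / 2 - 1) = m - 1 := by push_cast; ring
      have e3 : ((2 : ℕ) : ℝ) * ((1 : ℝ) / 2 - 1) = -1 := by norm_num
      rw [e2, e3, Real.rpow_neg_one, Real.rpow_sub_one hc.ne', Real.rpow_natCast]
      field_simp
    · rw [Set.indicator_of_notMem (mt hiff.1 h)]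
      simp
  · exact ENNReal.ofReal_ne_top
  · intro θ _
    have := (Real.hasDerivAt_cos θ).pow 2
    refine (this.congr_deriv ?_).hasDerivWithinAt
    simp
  · intro x ⟨hx0, hx1⟩ y ⟨hy0, hy1⟩ hxy
    have hcx := Real.cos_pos_of_mem_Ioo ⟨by linarith, hx1⟩
    have hcy := Real.cos_pos_of_mem_Ioo ⟨by linarith, hy1⟩
    exact Real.injOn_cos ⟨hx0.le, by linarith⟩ ⟨hy0.le, by linarith⟩
      ((sq_eq_sq₀ hcx.le hcy.le).1 hxy)

theorem lintegral_even_eq_two_mul {f : ℝ → ENNReal} (hf : ∀ x, f (-x) = f x) :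
    ∫⁻ x, f x = 2 * ∫⁻ x in Set.Ioi 0, f x := by
  rw [← lintegral_add_compl f (measurableSet_Ioi (a := 0)), Set.compl_Ioi,
    setLIntegral_congr Iio_ae_eq_Iic.symm, two_mul]
  congr 1
  have h := (Measure.measurePreserving_neg (volume : Measure ℝ)).setLIntegral_comp_preimage_emb
    (MeasurableEquiv.neg ℝ).measurableEmbedding f (Set.Ioi 0)
  simpa [hf] using h

theorem lintegral_cos_even (m : ℕ) (γ : ℝ) :
    (∫⁻ θ in Set.Ioo (-Real.pi) Real.pi,
      if 0 < Real.cos θ ∧ γ ≤ |Real.sin θ| then ENNReal.ofReal (Real.cos θ ^ m) else 0) =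
    2 * ∫⁻ θ in Set.Ioo 0 (Real.pi / 2),
        if γ ≤ Real.sin θ then ENNReal.ofReal (Real.cos θ ^ m) else 0 := by
  rw [← lintegral_indicator measurableSet_Ioo, lintegral_even_eq_two_mul,
    ← lintegral_indicator measurableSet_Ioi, ← lintegral_indicator measurableSet_Ioo]
  · congr 2 with θ
    by_cases h : θ ∈ Set.Ioo 0 (Real.pi / 2)
    · have h0 := h.1
      have h2 := h.2
      have hc := Real.cos_pos_of_mem_Ioo ⟨by linarith, h.2⟩
      have hs := Real.sin_pos_of_pos_of_lt_pi h.1 (by linarith [Real.pi_pos])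
      rw [Set.indicator_of_mem h, Set.indicator_of_mem (show θ ∈ Set.Ioi 0 from h0),
        Set.indicator_of_mem (show θ ∈ Set.Ioo (-Real.pi) Real.pi from
          ⟨by linarith, by linarith⟩)]
      simp [hc, abs_of_pos hs]
    · rw [Set.indicator_of_notMem h]
      refine Set.indicator_apply_eq_zero.2 fun h0 ↦ Set.indicator_apply_eq_zero.2 fun h1 ↦ ?_
      refine if_neg fun hc ↦ not_le_of_gt hc.1 ?_
      refine Real.cos_nonpos_of_pi_div_two_le_of_le (not_lt.1 fun h2 ↦ h ⟨h0, h2⟩) ?_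
      linarith [h1.2, Real.pi_pos]
  · intro x
    have : -x ∈ Set.Ioo (-Real.pi) Real.pi ↔ x ∈ Set.Ioo (-Real.pi) Real.pi := by
      simp only [Set.mem_Ioo]
      constructor <;> rintro ⟨h1, h2⟩ <;> constructor <;> linarith
    simp only [Set.indicator_apply, this, Real.cos_neg, Real.sin_neg, abs_neg]

/-! ### Splitting off the coordinate along `g` -/

theorem measurePreserving_gaussianDir_succ (n : ℕ) :
    MeasurePreserving (fun u : EuclideanSpace ℝ (Fin (n + 1)) ↦
      (u 0, (WithLp.toLp 2 fun i ↦ u i.succ : EuclideanSpace ℝ (Fin n))))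
      (gaussianDir (n + 1)) ((ProbabilityTheory.gaussianReal 0 1).prod (gaussianDir n)) := by
  refine ⟨by fun_prop, ?_⟩
  simp_rw [gaussianDir_eq_stdGaussian, ← ProbabilityTheory.map_pi_eq_stdGaussian]
  rw [Measure.map_map (by fun_prop) (by fun_prop)]
  have h := (measurePreserving_piFinSuccAbove
    (fun _ : Fin (n + 1) ↦ ProbabilityTheory.gaussianReal 0 1) 0).map_eq
  have h2 := Measure.map_prod_map (ProbabilityTheory.gaussianReal 0 1)
    (Measure.pi fun _ : Fin n ↦ ProbabilityTheory.gaussianReal 0 1) measurable_id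
    (WithLp.measurable_toLp 2 (Fin n → ℝ))
  rw [Measure.map_id] at h2
  rw [h2, ← h, Measure.map_map (by fun_prop) (by fun_prop)]
  rfl

theorem gaussianDir_cone_eq_prod (n : ℕ) {g : EuclideanSpace ℝ (Fin (n + 1))} (hg : g ≠ 0) (γ : ℝ) :
    gaussianDir (n + 1) {u | γ * ‖u‖ * ‖g‖ ≤ |inner ℝ u g|} =
      ((ProbabilityTheory.gaussianReal 0 1).prod (gaussianDir n))
        {p | γ * √(p.1 ^ 2 + ‖p.2‖ ^ 2) ≤ |p.1|} := by
  have hg' : 0 < ‖g‖ := norm_pos_iff.2 hg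
  set e : EuclideanSpace ℝ (Fin (n + 1)) := EuclideanSpace.single 0 1
  set w := ‖g‖⁻¹ • g
  have hw : ‖e‖ = ‖w‖ := by simp [e, w, norm_smul, hg'.ne']
  -- The reflection in the hyperplane orthogonal to `e - w` swaps these two unit vectors and
  -- preserves the Gaussian.
  set R := Submodule.reflection (ℝ ∙ (e - w))ᗮ
  have hR : R e = w := Submodule.reflection_sub hw
  have hmeas : MeasurableSet {p : ℝ × EuclideanSpace ℝ (Fin n) |
      γ * √(p.1 ^ 2 + ‖p.2‖ ^ 2) ≤ |p.1|} := measurableSet_le (by fun_prop) (by fun_prop)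
  have hmeas' : MeasurableSet {u : EuclideanSpace ℝ (Fin (n + 1)) |
      γ * ‖u‖ * ‖g‖ ≤ |inner ℝ u g|} := measurableSet_le (by fun_prop) (by fun_prop)
  have hmap : (gaussianDir (n + 1)).map R = gaussianDir (n + 1) := by
    rw [gaussianDir_eq_stdGaussian]
    exact ProbabilityTheory.stdGaussian_map R
  rw [← (measurePreserving_gaussianDir_succ n).measure_preimage hmeas.nullMeasurableSet,
    ← hmap, Measure.map_apply R.continuous.measurable hmeas', hmap]
  congr 1 with u
  have h1 : inner ℝ (R u) g = ‖g‖ * u 0 := by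
    have : g = ‖g‖ • R e := by rw [hR, smul_smul, mul_inv_cancel₀ hg'.ne', one_smul]
    conv_lhs => rw [this]
    rw [inner_smul_right, R.inner_map_map]
    simp [e, EuclideanSpace.inner_single_right]
  have h2 : ‖u‖ = √(u 0 ^ 2 + ‖(WithLp.toLp 2 fun i ↦ u i.succ : EuclideanSpace ℝ (Fin n))‖ ^ 2) := by
    rw [EuclideanSpace.norm_eq, EuclideanSpace.norm_sq_eq, Fin.sum_univ_succ]
    simp
  simp only [Set.mem_preimage, Set.mem_ofPred_eq, R.norm_map, h1, abs_mul, abs_norm, ← h2]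
  rw [mul_comm, mul_le_mul_iff_right₀ hg']

/-! ### Identification with the Beta law -/

/-- With `r = ρ cos θ` and `z = ρ sin θ`, the cone condition involves only `θ` and the exponential
only `ρ`. Keeping `0 < r` inside the integrand lets both integrals run over the full plane. -/
theorem lintegral_cone_polar (m : ℕ) (γ k : ℝ) (hk : 0 ≤ k) :
    (∫⁻ r, ∫⁻ z, if 0 < r ∧ γ * √(z ^ 2 + r ^ 2) ≤ |z| then
      ENNReal.ofReal (k * r ^ m * Real.exp (-(z ^ 2 + r ^ 2) / 2)) else 0) =
    (∫⁻ ρ in Set.Ioi (0 : ℝ), ENNReal.ofReal (ρ * (k * ρ ^ m * Real.exp (-ρ ^ 2 / 2)))) *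
      ∫⁻ θ in Set.Ioo (-Real.pi) Real.pi,
        if 0 < Real.cos θ ∧ γ ≤ |Real.sin θ| then ENNReal.ofReal (Real.cos θ ^ m) else 0 := by
  have hset : MeasurableSet {p : ℝ × ℝ | 0 < p.1 ∧ γ * √(p.2 ^ 2 + p.1 ^ 2) ≤ |p.2|} := by
    rw [Set.ofPred_and]
    exact (measurableSet_lt (by fun_prop) (by fun_prop)).inter
      (measurableSet_le (by fun_prop) (by fun_prop))
  have hset2 : MeasurableSet {θ : ℝ | 0 < Real.cos θ ∧ γ ≤ |Real.sin θ|} := by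
    rw [Set.ofPred_and]
    exact (measurableSet_lt (by fun_prop) (by fun_prop)).inter
      (measurableSet_le (by fun_prop) (by fun_prop))
  have hmeas : Measurable fun p : ℝ × ℝ ↦ if 0 < p.1 ∧ γ * √(p.2 ^ 2 + p.1 ^ 2) ≤ |p.2| then
      ENNReal.ofReal (k * p.1 ^ m * Real.exp (-(p.2 ^ 2 + p.1 ^ 2) / 2)) else 0 :=
    Measurable.ite hset (by fun_prop) measurable_const
  have hmeas2 : Measurable fun θ : ℝ ↦
      if 0 < Real.cos θ ∧ γ ≤ |Real.sin θ| then ENNReal.ofReal (Real.cos θ ^ m) else 0 :=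
    Measurable.ite hset2 (by fun_prop) measurable_const
  rw [← lintegral_prod _ hmeas.aemeasurable, ← Measure.volume_eq_prod,
    ← lintegral_comp_polarCoord_symm, ← lintegral_prod_mul (by fun_prop) hmeas2.aemeasurable,
    Measure.prod_restrict, ← Measure.volume_eq_prod]
  refine setLIntegral_congr_fun polarCoord.open_target.measurableSet fun q hq ↦ ?_
  have hρ : 0 < q.1 := hq.1
  have hsq : (q.1 * Real.sin q.2) ^ 2 + (q.1 * Real.cos q.2) ^ 2 = q.1 ^ 2 := by
    linear_combination q.1 ^ 2 * Real.sin_sq_add_cos_sq q.2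
  simp only [polarCoord_symm_apply, hsq, Real.sqrt_sq hρ.le, abs_mul, abs_of_pos hρ,
    mul_pos_iff_of_pos_left hρ, mul_comm γ, mul_le_mul_iff_right₀ hρ, smul_eq_mul]
  split_ifs
  · rw [← ENNReal.ofReal_mul hρ.le, ← ENNReal.ofReal_mul (by positivity)]
    congr 1
    ring
  · simp

/-- Only independence of `K` from `γ` matters: its value is recovered later by normalization, which
avoids evaluating the surface area and the radial integral. -/
theorem exists_cone_eq_mul_betaMeasure (m : ℕ) : ∃ K : ENNReal, ∀ γ : ℝ, 0 ≤ γ →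
    ((ProbabilityTheory.gaussianReal 0 1).prod (gaussianDir (m + 1)))
        {p | γ * √(p.1 ^ 2 + ‖p.2‖ ^ 2) ≤ |p.1|} =
      K * ProbabilityTheory.betaMeasure ((m + 1) / 2) (1 / 2) (Set.Iic (1 - γ ^ 2)) := by
  set E := EuclideanSpace ℝ (Fin (m + 1))
  have hdim : Module.finrank ℝ E = m + 1 := by simp [E]
  set c : ℝ := (2 * Real.pi) ^ (-(Module.finrank ℝ E / 2 : ℝ))
  have hc : 0 ≤ c := by positivity
  set b : ℝ := (√(2 * Real.pi))⁻¹
  set B : ℝ := ProbabilityTheory.beta (((m : ℝ) + 1) / 2) (1 / 2)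
  have hB : 0 < B := ProbabilityTheory.beta_pos (by positivity) (by norm_num)
  set M := ∫⁻ ρ in Set.Ioi (0 : ℝ), ENNReal.ofReal (ρ * (c * b * ρ ^ m * Real.exp (-ρ ^ 2 / 2)))
  refine ⟨(volume : Measure E).toSphere Set.univ * (M * (2 * ENNReal.ofReal (B / 2))),
    fun γ hγ ↦ ?_⟩
  have hS : MeasurableSet {p : ℝ × E | γ * √(p.1 ^ 2 + ‖p.2‖ ^ 2) ≤ |p.1|} :=
    measurableSet_le (by fun_prop) (by fun_prop)
  have hT : MeasurableSet {p : ℝ × ℝ | γ * √(p.1 ^ 2 + p.2 ^ 2) ≤ |p.1|} :=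
    measurableSet_le (by fun_prop) (by fun_prop)
  -- The slice probability depends on `y` only through `‖y‖`, so the integral over `y` becomes
  -- radial with weight `r ^ m`.
  set H : ℝ → ENNReal := fun r ↦ ProbabilityTheory.gaussianReal 0 1
    ((fun z ↦ (z, r)) ⁻¹' {p : ℝ × ℝ | γ * √(p.1 ^ 2 + p.2 ^ 2) ≤ |p.1|})
  have hH : Measurable H := measurable_measure_prodMk_right hT
  have hHr : ∀ r, H r = ∫⁻ z, if γ * √(z ^ 2 + r ^ 2) ≤ |z| then
      ENNReal.ofReal (b * Real.exp (-z ^ 2 / 2)) else 0 := fun r ↦ by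
    have hTr := measurable_prodMk_right (y := r) hT
    simp only [H]
    rw [ProbabilityTheory.gaussianReal_apply _ one_ne_zero, ← lintegral_indicator hTr]
    refine lintegral_congr fun z ↦ ?_
    simp [Set.indicator_apply, ProbabilityTheory.gaussianPDF, ProbabilityTheory.gaussianPDFReal, b]
  rw [Measure.prod_apply_symm hS]
  change ∫⁻ y, H ‖y‖ ∂gaussianDir (m + 1) = _
  rw [gaussianDir_eq_stdGaussian, stdGaussian_eq_withDensity,
    lintegral_withDensity_eq_lintegral_mul _ (by fun_prop) (by fun_prop), ← setLIntegral_univ]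
  have hpolar := setLIntegral_cone_fun_norm (volume : Measure E) MeasurableSet.univ (by simp)
    (h := fun r ↦ ENNReal.ofReal (c * Real.exp (-r ^ 2 / 2)) * H r) (by fun_prop)
  rw [Set.preimage_univ] at hpolar
  refine hpolar.trans ?_
  rw [mul_assoc]
  congr 1
  have hbeta : ENNReal.ofReal (B / 2) * ProbabilityTheory.betaMeasure ((m + 1) / 2) (1 / 2)
      (Set.Iic (1 - γ ^ 2)) = ∫⁻ θ in Set.Ioo 0 (Real.pi / 2),
        if γ ≤ Real.sin θ then ENNReal.ofReal (Real.cos θ ^ m) else 0 := by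
    rw [betaMeasure_Iic_eq_lintegral_cos m hγ, ← mul_assoc, ← ENNReal.ofReal_mul (by positivity),
      div_mul_div_cancel₀ two_ne_zero, div_self hB.ne', ENNReal.ofReal_one, one_mul]
  rw [mul_assoc, mul_assoc, hbeta, ← lintegral_cos_even, ← lintegral_cone_polar _ _ _ (by positivity),
    ← lintegral_indicator measurableSet_Ioi]
  refine lintegral_congr fun r ↦ ?_
  by_cases hr : r ∈ Set.Ioi (0 : ℝ)
  · have hr0 : 0 < r := hr
    rw [Set.indicator_of_mem hr, hHr, ← mul_assoc, ← ENNReal.ofReal_mul (by positivity),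
      ← lintegral_const_mul' _ _ ENNReal.ofReal_ne_top]
    refine lintegral_congr fun z ↦ ?_
    simp only [hr0, true_and]
    split_ifs
    · rw [← ENNReal.ofReal_mul (by positivity), hdim, Nat.add_sub_cancel, neg_add, add_div,
        Real.exp_add]
      congr 1
      ring
    · simp
  · rw [Set.indicator_of_notMem hr]
    simp [show ¬ 0 < r from hr]

theorem cone_eq_betaMeasure (m : ℕ) {γ : ℝ} (hγ : 0 ≤ γ) :
    ((ProbabilityTheory.gaussianReal 0 1).prod (gaussianDir (m + 1)))
        {p | γ * √(p.1 ^ 2 + ‖p.2‖ ^ 2) ≤ |p.1|} =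
      ProbabilityTheory.betaMeasure ((m + 1) / 2) (1 / 2) (Set.Iic (1 - γ ^ 2)) := by
  obtain ⟨K, hK⟩ := exists_cone_eq_mul_betaMeasure m
  -- At `γ = 0` both events have probability one, hence `K = 1`.
  have h0 := hK 0 le_rfl
  have hae : (Set.Iic ((1 : ℝ) - 0 ^ 2))ᶜ ⊆ Set.Ioi 1 := by simp
  have hprob : ProbabilityTheory.betaMeasure (((m : ℝ) + 1) / 2) (1 / 2)
      (Set.Iic (1 - 0 ^ 2)) = 1 := by
    have : IsProbabilityMeasure (ProbabilityTheory.betaMeasure (((m : ℝ) + 1) / 2) (1 / 2)) :=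
      ProbabilityTheory.isProbabilityMeasureBeta (by positivity) (by norm_num)
    rw [prob_compl_eq_zero_iff measurableSet_Iic |>.symm]
    refine measure_mono_null hae ?_
    rw [ProbabilityTheory.betaMeasure, withDensity_apply _ measurableSet_Ioi]
    exact setLIntegral_eq_zero measurableSet_Ioi fun x hx ↦
      ProbabilityTheory.betaPDF_eq_zero_of_one_le (Set.mem_Ioi.1 hx).le
  rw [hprob, mul_one] at h0
  rw [hK γ hγ, ← h0]
  simp

theorem betaMeasure_real_Iic {a b x : ℝ} (ha : 0 < a) (hb : 0 < b) (hx0 : 0 ≤ x) (hx1 : x ≤ 1) :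
    (ProbabilityTheory.betaMeasure a b).real (Set.Iic x) = regIncBeta x a b := by
  have hB := ProbabilityTheory.beta_pos ha hb
  rw [regIncBeta, intervalIntegral.integral_of_le hx0, ← integral_div,
    integral_Ioc_eq_integral_Ioo, measureReal_def, ProbabilityTheory.betaMeasure,
    withDensity_apply _ measurableSet_Iic, ← Set.Iic_union_Ioc_eq_Iic hx0,
    lintegral_union measurableSet_Ioc (Set.Iic_disjoint_Ioc le_rfl),
    setLIntegral_eq_zero measurableSet_Iic fun t ht ↦
      ProbabilityTheory.betaPDF_eq_zero_of_nonpos ht, zero_add,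
    setLIntegral_congr Ioo_ae_eq_Ioc.symm, integral_eq_lintegral_of_nonneg_ae]
  · congr 1
    refine setLIntegral_congr_fun measurableSet_Ioo fun t ht ↦ ?_
    rw [ProbabilityTheory.betaPDF_of_pos_lt_one ht.1 (ht.2.trans_le hx1)]
    congr 1
    ring
  · refine (ae_restrict_iff' measurableSet_Ioo).2 (ae_of_all _ fun t ht ↦ ?_)
    have h0 := ht.1
    have h1 : 0 < 1 - t := by linarith [ht.2]
    simp only [Pi.zero_apply]
    positivity
  · exact Measurable.aestronglyMeasurable (by fun_prop)

/-! ### The dimension-free lower bound -/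

open ProbabilityTheory in
theorem gaussianReal_real_le_abs {a : ℝ} (ha : 0 ≤ a) :
    (gaussianReal 0 1).real {z | a ≤ |z|} = 1 - 2 * ∫ z in (0 : ℝ)..a, gaussianPDFReal 0 1 z := by
  have hint : ∀ s t, IntervalIntegrable (gaussianPDFReal 0 1) volume s t := fun s t ↦
    (integrable_gaussianPDFReal 0 1).intervalIntegrable
  have hm : MeasurableSet {z : ℝ | a ≤ |z|} := measurableSet_le (by fun_prop) (by fun_prop)
  have hc : {z : ℝ | a ≤ |z|}ᶜ = Set.Ioo (-a) a := by
    ext z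
    simp [abs_lt]
  have h := probReal_compl_eq_one_sub (μ := gaussianReal 0 1) hm
  rw [hc] at h
  have h2 : (gaussianReal 0 1).real (Set.Ioo (-a) a) = ∫ z in (-a)..a, gaussianPDFReal 0 1 z := by
    rw [measureReal_def, gaussianReal_apply_eq_integral _ one_ne_zero, ENNReal.toReal_ofReal
      (integral_nonneg fun _ ↦ gaussianPDFReal_nonneg _ _ _),
      intervalIntegral.integral_of_le (by linarith), integral_Ioc_eq_integral_Ioo]
  have h3 : ∫ z in (-a)..0, gaussianPDFReal 0 1 z = ∫ z in (0 : ℝ)..a, gaussianPDFReal 0 1 z := by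
    have := intervalIntegral.integral_comp_neg (a := 0) (b := a) (gaussianPDFReal 0 1)
    rw [neg_zero] at this
    rw [← this]
    simp [gaussianPDFReal]
  rw [h2, ← intervalIntegral.integral_add_adjacent_intervals (hint (-a) 0) (hint 0 a), h3] at h
  linarith

-- Tangent line at `s = 1` of `s ↦ P(|z| ≥ √s)`, with `s = a²`. It follows by integrating the
-- comparison of the density `φ(z)` with `φ(1) z`: below it for `z ≥ 1`, above it on `[0, 1]`.
open ProbabilityTheory in
theorem gaussianReal_real_le_abs_tangent {a : ℝ} (ha : 0 ≤ a) :
    (gaussianReal 0 1).real {z | 1 ≤ |z|} - gaussianPDFReal 0 1 1 * (a ^ 2 - 1) ≤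
      (gaussianReal 0 1).real {z | a ≤ |z|} := by
  have hint : ∀ s t, IntervalIntegrable (gaussianPDFReal 0 1) volume s t := fun s t ↦
    (integrable_gaussianPDFReal 0 1).intervalIntegrable
  have hlin : ∀ s t, IntervalIntegrable (fun z ↦ gaussianPDFReal 0 1 1 * z) volume s t :=
    fun s t ↦ (by fun_prop : Continuous _).intervalIntegrable _ _
  have hval : ∀ z : ℝ, gaussianPDFReal 0 1 z =
      gaussianPDFReal 0 1 1 * Real.exp ((1 - z ^ 2) / 2) := by
    intro z
    simp only [gaussianPDFReal, mul_assoc, ← Real.exp_add]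
    congr 2
    norm_num
    ring
  have hq : 0 ≤ gaussianPDFReal 0 1 1 := gaussianPDFReal_nonneg _ _ _
  have hI : ∫ z in (1 : ℝ)..a, gaussianPDFReal 0 1 z ≤ gaussianPDFReal 0 1 1 * (a ^ 2 - 1) / 2 := by
    have e : gaussianPDFReal 0 1 1 * (a ^ 2 - 1) / 2 =
        ∫ z in (1 : ℝ)..a, gaussianPDFReal 0 1 1 * z := by
      rw [intervalIntegral.integral_const_mul, integral_id]
      ring
    rw [e]
    rcases le_total 1 a with h | h
    · refine intervalIntegral.integral_mono_on h (hint _ _) (hlin _ _) fun z hz ↦ ?_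
      rw [hval z]
      refine mul_le_mul_of_nonneg_left (le_trans (Real.exp_le_one_iff.2 ?_) hz.1) hq
      nlinarith [hz.1]
    · rw [intervalIntegral.integral_symm, intervalIntegral.integral_symm a, neg_le_neg_iff]
      refine intervalIntegral.integral_mono_on h (hlin _ _) (hint _ _) fun z hz ↦ ?_
      rw [hval z]
      refine mul_le_mul_of_nonneg_left (le_trans hz.2 (Real.one_le_exp ?_)) hq
      nlinarith [hz.1, hz.2]
  have hadd := intervalIntegral.integral_add_adjacent_intervals (hint 0 1) (hint 1 a)
  rw [gaussianReal_real_le_abs ha, gaussianReal_real_le_abs zero_le_one]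
  linarith

theorem exp_neg_sq_div_two_le {x : ℝ} (h0 : 0 ≤ x) (h1 : x ≤ 1) :
    Real.exp (-x ^ 2 / 2) ≤ 1 - x ^ 2 / 2 + x ^ 4 / 8 - x ^ 6 / 48 + x ^ 8 * (5 / 1536) := by
  have hx : |-x ^ 2 / 2| = x ^ 2 / 2 := by
    rw [neg_div, abs_neg, abs_of_nonneg (by positivity)]
  -- The remainder after four Taylor terms is at most `5/96 · (x²/2)⁴`, the source of `5/1536`.
  have h := (abs_le.1 (Real.exp_bound (x := -x ^ 2 / 2) (by rw [hx]; nlinarith)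
    (n := 4) (by norm_num))).2
  rw [hx] at h
  norm_num [Finset.sum_range_succ, Nat.factorial] at h
  ring_nf at h ⊢
  linarith

open ProbabilityTheory in
theorem gaussianReal_real_one_le_abs : 0.315603 ≤ (gaussianReal 0 1).real {z | 1 ≤ |z|} := by
  rw [gaussianReal_real_le_abs zero_le_one]
  -- Coarse constants suffice: `1 - 2 · 0.85572 / 2.501` is about `0.31570`.
  have hs : 2.501 < √(2 * Real.pi) := Real.lt_sqrt_of_sq_lt (by linarith [Real.pi_gt_d2])
  have hexp : ∫ z in (0 : ℝ)..1, Real.exp (-z ^ 2 / 2) ≤ 0.85572 := by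
    calc ∫ z in (0 : ℝ)..1, Real.exp (-z ^ 2 / 2)
        ≤ ∫ x in (0 : ℝ)..1,
          (1 - x ^ 2 / 2 + x ^ 4 / 8 - x ^ 6 / 48 + x ^ 8 * (5 / 1536)) :=
          intervalIntegral.integral_mono_on zero_le_one
            ((by fun_prop : Continuous _).intervalIntegrable _ _)
            ((by fun_prop : Continuous _).intervalIntegrable _ _)
            fun x hx ↦ exp_neg_sq_div_two_le hx.1 hx.2
      _ = 1 - 1 / 6 + 1 / 40 - 1 / 336 + 5 / 13824 := by
          have hi : ∀ f : ℝ → ℝ, Continuous f → IntervalIntegrable f volume 0 1 :=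
            fun f hf ↦ hf.intervalIntegrable _ _
          rw [intervalIntegral.integral_add (hi _ (by fun_prop)) (hi _ (by fun_prop)),
            intervalIntegral.integral_sub (hi _ (by fun_prop)) (hi _ (by fun_prop)),
            intervalIntegral.integral_add (hi _ (by fun_prop)) (hi _ (by fun_prop)),
            intervalIntegral.integral_sub (hi _ (by fun_prop)) (hi _ (by fun_prop))]
          norm_num
      _ ≤ 0.85572 := by norm_num
  have heq : ∫ z in (0 : ℝ)..1, gaussianPDFReal 0 1 z =
      (∫ z in (0 : ℝ)..1, Real.exp (-z ^ 2 / 2)) / √(2 * Real.pi) := by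
    rw [div_eq_inv_mul, ← intervalIntegral.integral_const_mul]
    simp [gaussianPDFReal]
  have : (∫ z in (0 : ℝ)..1, Real.exp (-z ^ 2 / 2)) / √(2 * Real.pi) ≤ 0.85572 / 2.501 :=
    div_le_div₀ (by norm_num) hexp (by norm_num) hs.le
  rw [heq]
  norm_num at this ⊢
  linarith

theorem measurePreserving_eval_gaussianDir (n : ℕ) (i : Fin n) :
    MeasurePreserving (fun y : EuclideanSpace ℝ (Fin n) ↦ y i) (gaussianDir n)
      (ProbabilityTheory.gaussianReal 0 1) := by
  have h := ProbabilityTheory.measurePreserving_eval_multivariateGaussian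
    (μ := (0 : EuclideanSpace ℝ (Fin n))) (Matrix.PosSemidef.one (n := Fin n) (R := ℝ)) (i := i)
  simpa [gaussianDir_eq_stdGaussian] using h

theorem integrable_sq_gaussianReal :
    Integrable (fun z : ℝ ↦ z ^ 2) (ProbabilityTheory.gaussianReal 0 1) :=
  (ProbabilityTheory.memLp_id_gaussianReal 2).integrable_sq

theorem integral_sq_gaussianReal : ∫ z, z ^ 2 ∂ProbabilityTheory.gaussianReal 0 1 = 1 := by
  have h := ProbabilityTheory.variance_id_gaussianReal (μ := 0) (v := 1)
  rw [ProbabilityTheory.variance_of_integral_eq_zero aemeasurable_id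
    (by simp)] at h
  simpa using h

theorem integrable_norm_sq_gaussianDir (n : ℕ) :
    Integrable (fun y ↦ ‖y‖ ^ 2) (gaussianDir n) := by
  simp_rw [EuclideanSpace.real_norm_sq_eq]
  exact integrable_finsetSum _ fun i _ ↦
    (measurePreserving_eval_gaussianDir n i).integrable_comp_of_integrable integrable_sq_gaussianReal

theorem integral_norm_sq_gaussianDir (n : ℕ) : ∫ y, ‖y‖ ^ 2 ∂gaussianDir n = n := by
  simp_rw [EuclideanSpace.real_norm_sq_eq]
  have h := fun i : Fin n ↦ measurePreserving_eval_gaussianDir n i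
  have hi : ∀ i : Fin n, Integrable (fun y : EuclideanSpace ℝ (Fin n) ↦ y i ^ 2) (gaussianDir n) :=
    fun i ↦ (h i).integrable_comp_of_integrable integrable_sq_gaussianReal
  rw [integral_finsetSum _ fun i _ ↦ hi i]
  have h2 : ∀ i : Fin n, ∫ y : EuclideanSpace ℝ (Fin n), y i ^ 2 ∂gaussianDir n = 1 := fun i ↦ by
    rw [← integral_sq_gaussianReal, ← (h i).map_eq,
      integral_map (h i).measurable.aemeasurable (by fun_prop)]
  simp [h2]

theorem le_prod_gaussian_cone (m : ℕ) :
    0.315603 ≤ ((ProbabilityTheory.gaussianReal 0 1).prod (gaussianDir (m + 1))).real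
      {p | 1 / √((m + 2 : ℕ) : ℝ) * √(p.1 ^ 2 + ‖p.2‖ ^ 2) ≤ |p.1|} := by
  have hS : MeasurableSet {p : ℝ × EuclideanSpace ℝ (Fin (m + 1)) |
      1 / √((m + 2 : ℕ) : ℝ) * √(p.1 ^ 2 + ‖p.2‖ ^ 2) ≤ |p.1|} :=
    measurableSet_le (by fun_prop) (by fun_prop)
  have hm : (0 : ℝ) < m + 1 := by positivity
  have hslice : ∀ y : EuclideanSpace ℝ (Fin (m + 1)), (fun z : ℝ ↦ (z, y)) ⁻¹'
      {p | 1 / √((m + 2 : ℕ) : ℝ) * √(p.1 ^ 2 + ‖p.2‖ ^ 2) ≤ |p.1|} =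
      {z | ‖y‖ / √(m + 1) ≤ |z|} := by
    intro y
    ext z
    simp only [Set.mem_preimage, Set.mem_ofPred_eq]
    rw [← sq_le_sq₀ (by positivity) (abs_nonneg z), ← sq_le_sq₀ (by positivity) (abs_nonneg z),
      mul_pow, div_pow, div_pow, Real.sq_sqrt (by positivity), Real.sq_sqrt (by positivity),
      Real.sq_sqrt hm.le, sq_abs, div_le_iff₀ hm, one_pow, one_div_mul_eq_div,
      div_le_iff₀ (by positivity)]
    push_cast
    constructor <;> intro h <;> linarith
  have hfin : ∀ᵐ y ∂gaussianDir (m + 1), ProbabilityTheory.gaussianReal 0 1 ((fun z : ℝ ↦ (z, y)) ⁻¹'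
      {p | 1 / √((m + 2 : ℕ) : ℝ) * √(p.1 ^ 2 + ‖p.2‖ ^ 2) ≤ |p.1|}) < ⊤ :=
    ae_of_all _ fun _ ↦ measure_lt_top _ _
  have hmeas := measurable_measure_prodMk_right (μ := ProbabilityTheory.gaussianReal 0 1) hS
  rw [measureReal_def, Measure.prod_apply_symm hS, ← integral_toReal hmeas.aemeasurable hfin]
  simp_rw [hslice] at hmeas ⊢
  refine gaussianReal_real_one_le_abs.trans ?_
  set q := ProbabilityTheory.gaussianPDFReal 0 1 1
  set R := (ProbabilityTheory.gaussianReal 0 1).real {z | 1 ≤ |z|}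
  have hnorm := integrable_norm_sq_gaussianDir (m + 1)
  have hint' : Integrable (fun y ↦ q * (‖y‖ ^ 2 / (m + 1) - 1)) (gaussianDir (m + 1)) :=
    ((hnorm.div_const _).sub (integrable_const _)).const_mul _
  have hint : Integrable (fun y ↦ R - q * (‖y‖ ^ 2 / (m + 1) - 1)) (gaussianDir (m + 1)) :=
    (integrable_const _).sub hint'
  -- The linear term has mean zero because `‖y‖²` has mean `m + 1`.
  calc R = ∫ y, (R - q * (‖y‖ ^ 2 / (m + 1) - 1)) ∂gaussianDir (m + 1) := by
        rw [integral_sub (integrable_const _) hint', integral_const_mul,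
          integral_sub (hnorm.div_const _) (integrable_const _), integral_div,
          integral_norm_sq_gaussianDir]
        push_cast
        simp [hm.ne']
    _ ≤ _ := by
        refine integral_mono hint ?_ fun y ↦ ?_
        · refine Integrable.of_bound hmeas.ennreal_toReal.aestronglyMeasurable 1
            (ae_of_all _ fun y ↦ ?_)
          rw [Real.norm_of_nonneg ENNReal.toReal_nonneg]
          exact measureReal_le_one
        · have h := gaussianReal_real_le_abs_tangent (a := ‖y‖ / √(m + 1)) (by positivity)
          rwa [div_pow, Real.sq_sqrt hm.le] at h

/-! ### Coordinate directions -/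

theorem le_coordDir_real {d : ℕ} (hd : 1 ≤ d) (g : EuclideanSpace ℝ (Fin d)) :
    1 / (d : ℝ) ≤ (coordDir d).real {u | |inner ℝ u g| ≥ ‖u‖ * ‖g‖ / √(d : ℝ)} := by
  have : NeZero d := ⟨by omega⟩
  have hd0 : (0 : ℝ) < d := by exact_mod_cast hd
  obtain ⟨i, -, hi⟩ := Finset.exists_max_image Finset.univ (fun i ↦ |g i|)
    (Finset.univ_nonempty (α := Fin d))
  -- The largest squared coordinate is at least the average `‖g‖²/d`.
  have hg : ‖g‖ / √(d : ℝ) ≤ |g i| := by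
    rw [← sq_le_sq₀ (by positivity) (abs_nonneg _), div_pow, Real.sq_sqrt hd0.le,
      div_le_iff₀ hd0, EuclideanSpace.real_norm_sq_eq]
    calc ∑ j, g j ^ 2 ≤ ∑ _j : Fin d, |g i| ^ 2 :=
          Finset.sum_le_sum fun j hj ↦ by
            rw [← sq_abs]
            exact pow_le_pow_left₀ (abs_nonneg _) (hi j hj) 2
      _ = |g i| ^ 2 * d := by simp [mul_comm]
  set s : Set (EuclideanSpace ℝ (Fin d)) :=
    Set.range fun i : Fin d ↦ EuclideanSpace.single i (1 : ℝ)
  have hs : s.Finite := Set.finite_range _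
  have hsub : {EuclideanSpace.single i (1 : ℝ)} ⊆
      {u : EuclideanSpace ℝ (Fin d) | |inner ℝ u g| ≥ ‖u‖ * ‖g‖ / √(d : ℝ)} := by
    rintro u rfl
    simpa [EuclideanSpace.inner_single_left] using hg
  refine le_trans ?_ (measureReal_mono hsub)
  have hcount : Measure.count s = d := by
    have hinj : Function.Injective fun i : Fin d ↦ EuclideanSpace.single i (1 : ℝ) := by
      intro a b hab
      by_contra hne
      have := congrArg (fun v : EuclideanSpace ℝ (Fin d) ↦ v a) hab
      simp [hne] at this
    simp only [s]
    rw [← Set.image_univ, Measure.count_injective_image hinj, Measure.count_univ]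
    simp
  have hmem : s ∩ {EuclideanSpace.single i (1 : ℝ)} = {EuclideanSpace.single i (1 : ℝ)} :=
    Set.inter_eq_right.2 (Set.singleton_subset_iff.2 ⟨i, rfl⟩)
  rw [coordDir, measureReal_def, ProbabilityTheory.uniformOn,
    ProbabilityTheory.cond_apply hs.measurableSet, hcount, hmem, Measure.count_singleton]
  simp

/-! ### Assembly -/

theorem measure_inner_cone_eq {d : ℕ} (hd : d ≠ 0) {D : Measure (EuclideanSpace ℝ (Fin d))}
    (hD : D = gaussianDir d ∨ D = sphereDir d) (g : EuclideanSpace ℝ (Fin d)) (γ : ℝ) :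
    D {u | γ * ‖u‖ * ‖g‖ ≤ |inner ℝ u g|} =
      gaussianDir d {u | γ * ‖u‖ * ‖g‖ ≤ |inner ℝ u g|} := by
  rcases hD with rfl | rfl
  · rfl
  refine sphereDir_cone_eq_gaussianDir hd (measurableSet_le (by fun_prop) (by fun_prop))
    fun r hr x ↦ ?_
  simp only [Set.mem_ofPred_eq, norm_smul, real_inner_smul_left, abs_mul, Real.norm_eq_abs,
    abs_of_pos hr]
  rw [show γ * (r * ‖x‖) * ‖g‖ = r * (γ * ‖x‖ * ‖g‖) by ring, mul_le_mul_iff_right₀ hr]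

theorem mainTheorem8 :
    (∀ (d : ℕ), 2 ≤ d →
      ∀ (D : Measure (EuclideanSpace ℝ (Fin d))), (D = gaussianDir d ∨ D = sphereDir d) →
        (∀ (g : EuclideanSpace ℝ (Fin d)), g ≠ 0 → ∀ (γ : ℝ), 0 < γ → γ ≤ 1 →
          D.real {u | |inner ℝ u g| ≥ γ * ‖u‖ * ‖g‖}
            = regIncBeta (1 - γ ^ 2) (((d : ℝ) - 1) / 2) (1 / 2)) ∧
        (∀ (g : EuclideanSpace ℝ (Fin d)),
          D.real {u | |inner ℝ u g| ≥ ‖u‖ * ‖g‖ / √(d : ℝ)} ≥ 0.315603)) ∧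
    (∀ (d : ℕ), 1 ≤ d → ∀ (g : EuclideanSpace ℝ (Fin d)),
      (coordDir d).real {u | |inner ℝ u g| ≥ ‖u‖ * ‖g‖ / √(d : ℝ)} ≥ 1 / (d : ℝ)) := by
  refine ⟨fun d hd D hD ↦ ?_, fun d hd g ↦ le_coordDir_real hd g⟩
  obtain ⟨m, rfl⟩ : ∃ m, d = m + 2 := ⟨d - 2, by omega⟩
  have key : ∀ g : EuclideanSpace ℝ (Fin (m + 2)), g ≠ 0 → ∀ γ : ℝ,
      D.real {u | γ * ‖u‖ * ‖g‖ ≤ |inner ℝ u g|} =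
        ((ProbabilityTheory.gaussianReal 0 1).prod (gaussianDir (m + 1))).real
          {p | γ * √(p.1 ^ 2 + ‖p.2‖ ^ 2) ≤ |p.1|} := fun g hg γ ↦ by
    rw [measureReal_def, measureReal_def, measure_inner_cone_eq (by omega) hD,
      gaussianDir_cone_eq_prod (m + 1) hg]
  refine ⟨fun g hg γ h0 h1 ↦ ?_, fun g ↦ ?_⟩
  · have ha : (((m + 2 : ℕ) : ℝ) - 1) / 2 = (m + 1) / 2 := by push_cast; ring
    rw [ha, ← betaMeasure_real_Iic (by positivity) (by norm_num) (by nlinarith) (by nlinarith)]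
    refine (key g hg γ).trans ?_
    rw [measureReal_def, cone_eq_betaMeasure m h0.le, measureReal_def]
  · have hprob : IsProbabilityMeasure D := by
      rcases hD with rfl | rfl <;> infer_instance
    rcases eq_or_ne g 0 with rfl | hg
    -- For `g = 0` the event is the whole space, of probability one.
    · simp
      norm_num
    · refine (le_prod_gaussian_cone m).trans (le_of_eq ?_)
      rw [← key g hg]
      congr 1 with u
      simp only [Set.mem_ofPred_eq, ge_iff_le]
      rw [one_div_mul_eq_div, div_mul_eq_mul_div]
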